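/- Let $G$ be a (smooth, real, possibly infinite-dimensional Banach) Lie group whose Lie algebra $\mathfrak g=T_eG$ is a reflexive Banach space with dual $\mathfrak g^*$. Let $R_g$ be right multiplication by $g$, let $T_e^*R_g:T_g^*G\to\mathfrak g^*$ be the dual of $T_eR_g$, let $\mathrm{Ad}_g=T_e(x\mapsto g^{-1}xg)$, let $\mathrm{ad}_\xi\eta=[\xi,\eta]$ be the derivative of $g\mapsto \mathrm{Ad}_g\eta$ at $e$ in the direction $\xi$ (equivalently, the bracket of right invariant vector fields), and let $\mathrm{ad}^*_\xi$ be defined by $\langle \mathrm{ad}^*_\xi\mu,\eta\rangle=\langle\mu,[\xi,\eta]\rangle$. Let ${}^1TT^*G=G\times\mathfrak g^*\times\mathfrak g\times\mathfrak g^*$ with points $(g,\mu,\xi,\nu)$, let ${}^1T\pi_G(g,\mu,\xi,\nu)=(g,\xi)$, and let $\theta_2$ be the one-form on ${}^1TT^*G$ given by $$\langle\theta_2,(V_g,V_\mu,V_\xi,V_\nu)\rangle=\langle\nu,TR_{g^{-1}}V_g\rangle+\langle\mu,V_\xi\rangle ;$$ equivalently, $\langle\theta_2,X\rangle=\langle\mu,\xi_3\rangle+\langle\nu,\xi_2\rangle+\langle\mu,[\xi,\xi_2]\rangle$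 for $X=(TR_g\xi_2,\ \nu_2+\mathrm{ad}^*_{\xi_2}\mu,\ \xi_3+[\xi,\xi_2],\ \nu_3+\mathrm{ad}^*_{\xi_2}\nu-\mathrm{ad}^*_\xi\nu_2)$. Put $\Omega=d\theta_2$. Let $\bar L:G\times\mathfrak g\to\mathbb R$ be smooth, and let $\delta\bar L/\delta g\in T_g^*G$ and $\delta\bar L/\delta\xi\in\mathfrak g^*$ be its partial differentials. Let $S$ be the set of points of ${}^1TT^*G$ at which $({}^1T\pi_G)^*d\bar L=\theta_2$. Then: 1. The exact form $\Omega$ is (strongly) non-degenerate, and $S$ is a smooth embedded Lagrangian submanifold of $({}^1TT^*G,\Omega)$, that is, $T_pS$ is equal to its own $\Omega$-orthogonal for every $p\in S$. 2. $S=\left\{\left(g,\dfrac{\delta\bar L}{\delta\xi},\xi,T_e^*R_g\dfrac{\delta\bar L}{\delta g}\right):(g,\xi)\in G\times\mathfrak g\right\}$. 3. The reconstruction map ${}^1TT^*G\to T(G\times\mathfrak g^*)$, $(g,\mu,\xi,\nu)\mapsto(g,\mu;\,T_eR_g\xi,\ \nu+\mathrm{ad}^*_\xi\mu)$, maps $S$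 onto $$S'=\left\{\left(g,\frac{\delta\bar L}{\delta\xi};\ T_eR_g\xi,\ T_e^*R_g\frac{\delta\bar L}{\delta g}+\mathrm{ad}^*_\xi\frac{\delta\bar L}{\delta\xi}\right):(g,\xi)\in G\times\mathfrak g\right\},$$ and $S'$ encodes the trivialized Euler–Lagrange equations: for every open $J\subseteq\mathbb R$ and all curves $t\mapsto g(t)\in G$, $t\mapsto\mu(t)\in\mathfrak g^*$, the curve $(g,\mu)$ is differentiable on $J$ with $(g,\mu;\dot g,\dot\mu)\in S'$ for all $t\in J$ if and only if, with $\xi=TR_{g^{-1}}\dot g$, the curve $g$ is differentiable on $J$, $\mu=\dfrac{\delta\bar L}{\delta\xi}(g,\xi)$ on $J$, and $$\frac{d}{dt}\frac{\delta\bar L}{\delta\xi}=T_e^*R_g\frac{\delta\bar L}{\delta g}+\mathrm{ad}^*_\xi\frac{\delta\bar L}{\delta\xi}\qquad\text{on }J$$ (in particular, $\delta\bar L/\delta\xi$ is differentiable along the curve). -/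

import Mathlib

open scoped Manifold ContDiff

noncomputable section

/-! ### One-forms, exterior derivative and Lagrangian submanifolds -/

section Manifolds

variable {E H M : Type*} [NormedAddCommGroup E] [NormedSpace ℝ E] [TopologicalSpace H]
  (I : ModelWithCorners ℝ E H) [TopologicalSpace M] [ChartedSpace H M]
  {E' H' N : Type*} [NormedAddCommGroup E'] [NormedSpace ℝ E'] [TopologicalSpace H']
  (I' : ModelWithCorners ℝ E' H') [TopologicalSpace N] [ChartedSpace H' N]

/-- The differential `df` of a real function, as a one-form. -/
def differential (f : M → ℝ) (x : M) : TangentSpace I x →L[ℝ] ℝ :=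
  mfderiv I 𝓘(ℝ, ℝ) f x

/-- The pullback `f^* α` of a one-form. -/
def pullbackForm (f : M → N) (α : ∀ y : N, TangentSpace I' y →L[ℝ] ℝ) (x : M) :
    TangentSpace I x →L[ℝ] ℝ :=
  (α (f x)).comp (mfderiv I I' f x)

/-- The expression of a one-form in the chart at `p`: the pullback of the form by the inverse
of the chart. -/
def formInChart (α : ∀ x : M, TangentSpace I x →L[ℝ] ℝ) (p : M) (y : E) : E →L[ℝ] ℝ :=
  pullbackForm 𝓘(ℝ, E) I (extChartAt I p).symm α y

/-- The exterior derivative of a one-form on a manifold without boundary, at `p`: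
`dα (u, v) = D_u a (v) - D_v a (u)`, where `a` is the expression of `α` in the chart at `p`.
`TangentSpace I p` is the model space, identified through the chart at `p`. -/
def exteriorDerivative (α : ∀ x : M, TangentSpace I x →L[ℝ] ℝ) (p : M) :
    TangentSpace I p →L[ℝ] TangentSpace I p →L[ℝ] ℝ :=
  show E →L[ℝ] E →L[ℝ] ℝ from
    fderiv ℝ (formInChart I α p) (extChartAt I p p) -
      (fderiv ℝ (formInChart I α p) (extChartAt I p p)).flip

/-- A chart `φ` of the smooth structure around `p` that flattens the subset `S` onto
the closed, complemented subspace `F` of the model space. -/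
structure IsSliceChart (S : Set M) (p : M) (φ : OpenPartialHomeomorph M H)
    (F : Submodule ℝ E) : Prop where
  mem_atlas : φ ∈ IsManifold.maximalAtlas I ∞ M
  mem_source : p ∈ φ.source
  complemented : F.ClosedComplemented
  slice : ∀ q ∈ φ.source, q ∈ S ↔ φ.extend I q ∈ F

/-- `S` is a (smooth, embedded) Lagrangian submanifold for the two-form `Ω`: around each of its
points it has a slice chart, and there its tangent space `(T_p φ)⁻¹ F` is equal to its own
`Ω`-orthogonal. -/
def IsLagrangianSubmanifold
    (Ω : ∀ p : M, TangentSpace I p →L[ℝ] TangentSpace I p →L[ℝ] ℝ) (S : Set M) : Prop :=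
  ∀ p ∈ S, ∃ (φ : OpenPartialHomeomorph M H) (F : Submodule ℝ E), IsSliceChart I S p φ F ∧
    ∀ v : TangentSpace I p, mfderiv I 𝓘(ℝ, E) (φ.extend I) p v ∈ F ↔
      ∀ w : TangentSpace I p, mfderiv I 𝓘(ℝ, E) (φ.extend I) p w ∈ F → Ω p v w = 0

end Manifolds

/-! ### Right trivializations on a Lie group

`G` is a Lie group modelled on the normed space `E`.  In Mathlib the tangent space of `G` at `1`
is by definition the space `E` (through the chart at `1`), so `E` is used as the underlying normed
space of the Lie algebra `𝔤` and `StrongDual ℝ E` as `𝔤^*`. -/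

section LieGroups

variable {E G : Type*} [NormedAddCommGroup E] [NormedSpace ℝ E]
  [TopologicalSpace G] [ChartedSpace E G] [Group G]

/-- `T_e R_g : 𝔤 → T_g G`. -/
def rightLift (g : G) : E →L[ℝ] TangentSpace 𝓘(ℝ, E) g :=
  show E →L[ℝ] E from mfderiv 𝓘(ℝ, E) 𝓘(ℝ, E) (fun x : G => x * g) 1

/-- `T_g R_{g⁻¹} : T_g G → 𝔤`. -/
def rightLower (g : G) : TangentSpace 𝓘(ℝ, E) g →L[ℝ] E :=
  show E →L[ℝ] E from mfderiv 𝓘(ℝ, E) 𝓘(ℝ, E) (fun x : G => x * g⁻¹) g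

/-- `T_e^* R_g : T_g^* G → 𝔤^*`. -/
def rightDual (g : G) (α : TangentSpace 𝓘(ℝ, E) g →L[ℝ] ℝ) : StrongDual ℝ E :=
  α.comp (rightLift g)

/-- The right adjoint action: the derivative at `1` of the right inner automorphism
`x ↦ g⁻¹ x g`. -/
def rightAd (g : G) : E →L[ℝ] E :=
  mfderiv 𝓘(ℝ, E) 𝓘(ℝ, E) (fun x : G => g⁻¹ * x * g) 1

variable (G) in
/-- `ad_ξ η = [ξ, η]`: the derivative at `1` of the right adjoint action. It is the bracket of
right invariant vector fields. -/
def rightad : E →L[ℝ] E →L[ℝ] E :=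
  show E →L[ℝ] E →L[ℝ] E from
    mfderiv 𝓘(ℝ, E) 𝓘(ℝ, E →L[ℝ] E) (fun g : G => (rightAd g : E →L[ℝ] E)) 1

variable (G) in
/-- `ad_ξ^*`, the linear dual of `ad_ξ`: `⟨ad_ξ^* μ, η⟩ = ⟨μ, [ξ, η]⟩`. -/
def adStar (ξ : E) (μ : StrongDual ℝ E) : StrongDual ℝ E :=
  μ.comp (rightad G ξ)

lemma rightLower_rightLift [LieGroup 𝓘(ℝ, E) ∞ G] (g : G) (ξ : E) :
    rightLower g (rightLift g ξ) = ξ := by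
  have hl : MDifferentiableAt 𝓘(ℝ, E) 𝓘(ℝ, E) (fun x : G => x * g) 1 :=
    (contMDiff_mul_right (I := 𝓘(ℝ, E)) (n := ∞)).contMDiffAt.mdifferentiableAt (by simp)
  have hr : MDifferentiableAt 𝓘(ℝ, E) 𝓘(ℝ, E) (fun x : G => x * g⁻¹) (1 * g) :=
    (contMDiff_mul_right (I := 𝓘(ℝ, E)) (n := ∞)).contMDiffAt.mdifferentiableAt (by simp)
  have h := mfderiv_comp (1 : G) hr hl
  have e : (fun x : G => x * g⁻¹) ∘ (fun x : G => x * g) = id := by ext x; simp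
  rw [e, mfderiv_id] at h
  have h2 := DFunLike.congr_fun h ξ
  have key : ∀ a : G, a = 1 * g → (show E →L[ℝ] E from
      mfderiv 𝓘(ℝ, E) 𝓘(ℝ, E) (fun x : G => x * g⁻¹) a) (rightLift g ξ) = ξ := by
    rintro _ rfl
    exact h2.symm
  exact key g (one_mul g).symm

lemma rightLift_rightLower [LieGroup 𝓘(ℝ, E) ∞ G] (g : G) (V : TangentSpace 𝓘(ℝ, E) g) :
    rightLift g (rightLower g V) = V := by
  have hl : MDifferentiableAt 𝓘(ℝ, E) 𝓘(ℝ, E) (fun x : G => x * g) (g * g⁻¹) :=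
    (contMDiff_mul_right (I := 𝓘(ℝ, E)) (n := ∞)).contMDiffAt.mdifferentiableAt (by simp)
  have hr : MDifferentiableAt 𝓘(ℝ, E) 𝓘(ℝ, E) (fun x : G => x * g⁻¹) g :=
    (contMDiff_mul_right (I := 𝓘(ℝ, E)) (n := ∞)).contMDiffAt.mdifferentiableAt (by simp)
  have h := mfderiv_comp g hl hr
  have e : (fun x : G => x * g) ∘ (fun x : G => x * g⁻¹) = id := by ext x; simp
  rw [e, mfderiv_id] at h
  have h2 := DFunLike.congr_fun h V
  have key : ∀ a : G, a = g * g⁻¹ → (show E →L[ℝ] E from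
      mfderiv 𝓘(ℝ, E) 𝓘(ℝ, E) (fun x : G => x * g) a) (rightLower g V) = V := by
    rintro _ rfl
    exact h2.symm
  exact key 1 (mul_inv_cancel g).symm

/-! ### The trivialized Tulczyjew space -/

variable (E) in
/-- The vector space `𝔤^* × 𝔤 × 𝔤^*`. -/
abbrev TulczyjewFibre : Type _ := StrongDual ℝ E × E × StrongDual ℝ E

variable (E G) in
/-- The manifold `¹TT^*G`, with points `(g, μ, ξ, ν)` in `G × 𝔤^* × 𝔤 × 𝔤^*`. -/
abbrev TulczyjewSpace : Type _ := G × TulczyjewFibre E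

variable (E) in
/-- The model with corners (without boundary) of `¹TT^*G`. -/
abbrev tulczyjewModel : ModelWithCorners ℝ (E × TulczyjewFibre E) (ModelProd E (TulczyjewFibre E)) :=
  𝓘(ℝ, E).prod 𝓘(ℝ, TulczyjewFibre E)

/-- The one-form `θ₂` on `¹TT^*G`: at `(g, μ, ξ, ν)` it takes the tangent vector
`(V_g, V_μ, V_ξ, V_ν)` to `⟨ν, TR_{g⁻¹} V_g⟩ + ⟨μ, V_ξ⟩`. See `theta2_rightInvariantField`. -/
def theta2 (p : TulczyjewSpace E G) : TangentSpace (tulczyjewModel E) p →L[ℝ] ℝ :=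
  show E × TulczyjewFibre E →L[ℝ] ℝ from
    (p.2.2.2.comp (rightLower p.1)).comp (ContinuousLinearMap.fst ℝ E (TulczyjewFibre E)) +
      p.2.1.comp ((ContinuousLinearMap.fst ℝ E (StrongDual ℝ E)).comp
        ((ContinuousLinearMap.snd ℝ (StrongDual ℝ E) (E × StrongDual ℝ E)).comp
          (ContinuousLinearMap.snd ℝ E (TulczyjewFibre E))))

/-- The value at `(g, μ, ξ, ν)` of the right invariant vector field on `¹TT^*G` generated by
the Lie algebra element `(ξ₂, ν₂, ξ₃, ν₃)`. -/
def rightInvariantField (ξ₂ : E) (ν₂ : StrongDual ℝ E) (ξ₃ : E) (ν₃ : StrongDual ℝ E)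
    (p : TulczyjewSpace E G) : TangentSpace (tulczyjewModel E) p :=
  show E × TulczyjewFibre E from
    (rightLift p.1 ξ₂, ν₂ + adStar G ξ₂ p.2.1, ξ₃ + rightad G p.2.2.1 ξ₂,
      ν₃ + adStar G ξ₂ p.2.2.2 - adStar G p.2.2.1 ν₂)

/-- The values of `θ₂` on right invariant vector fields:
`⟨θ₂, X⟩ = ⟨μ, ξ₃⟩ + ⟨ν, ξ₂⟩ + ⟨μ, [ξ, ξ₂]⟩`. -/
lemma theta2_rightInvariantField [LieGroup 𝓘(ℝ, E) ∞ G]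
    (ξ₂ : E) (ν₂ : StrongDual ℝ E) (ξ₃ : E) (ν₃ : StrongDual ℝ E) (p : TulczyjewSpace E G) :
    theta2 p (rightInvariantField ξ₂ ν₂ ξ₃ ν₃ p) =
      p.2.1 ξ₃ + p.2.2.2 ξ₂ + p.2.1 (rightad G p.2.2.1 ξ₂) := by
  change p.2.2.2 (rightLower p.1 (rightLift p.1 ξ₂)) +
    p.2.1 (ξ₃ + rightad G p.2.2.1 ξ₂) = _
  rw [rightLower_rightLift, map_add]
  ring

/-- Every tangent vector of `¹TT^*G` is a value of a right invariant vector field, so that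
`theta2_rightInvariantField` determines `θ₂`. -/
lemma exists_rightInvariantField_eq [LieGroup 𝓘(ℝ, E) ∞ G]
    (p : TulczyjewSpace E G) (X : TangentSpace (tulczyjewModel E) p) :
    ∃ ξ₂ ν₂ ξ₃ ν₃, rightInvariantField ξ₂ ν₂ ξ₃ ν₃ p = X := by
  obtain ⟨V, a, b, c⟩ := (show E × TulczyjewFibre E from X)
  refine ⟨rightLower p.1 V, a - adStar G (rightLower p.1 V) p.2.1,
    b - rightad G p.2.2.1 (rightLower p.1 V),
    c - adStar G (rightLower p.1 V) p.2.2.2 +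
      adStar G p.2.2.1 (a - adStar G (rightLower p.1 V) p.2.1), ?_⟩
  refine Prod.ext (rightLift_rightLower p.1 V) (Prod.ext ?_ (Prod.ext ?_ ?_))
  · change a - adStar G (rightLower p.1 V) p.2.1 + adStar G (rightLower p.1 V) p.2.1 = a
    abel
  · change b - rightad G p.2.2.1 (rightLower p.1 V) + rightad G p.2.2.1 (rightLower p.1 V) = b
    abel
  · change c - adStar G (rightLower p.1 V) p.2.2.2 +
      adStar G p.2.2.1 (a - adStar G (rightLower p.1 V) p.2.1) +
      adStar G (rightLower p.1 V) p.2.2.2 -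
      adStar G p.2.2.1 (a - adStar G (rightLower p.1 V) p.2.1) = c
    abel

/-- The two-form `Ω = dθ₂` on `¹TT^*G`. -/
def tulczyjewForm (p : TulczyjewSpace E G) :
    TangentSpace (tulczyjewModel E) p →L[ℝ] TangentSpace (tulczyjewModel E) p →L[ℝ] ℝ :=
  exteriorDerivative (tulczyjewModel E) theta2 p

/-- The projection `¹Tπ_G : (g, μ, ξ, ν) ↦ (g, ξ)`. -/
def tulczyjewProj (p : TulczyjewSpace E G) : G × E := (p.1, p.2.2.1)

/-! ### Lagrangian dynamics -/

/-- `δL/δξ` at `(g, ξ)`, an element of `𝔤^*`. -/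
def deltaXi (L : G × E → ℝ) (g : G) (ξ : E) : StrongDual ℝ E :=
  fderiv ℝ (fun η => L (g, η)) ξ

/-- `δL/δg` at `(g, ξ)`, an element of `T_g^* G`. -/
def deltaG (L : G × E → ℝ) (g : G) (ξ : E) : TangentSpace 𝓘(ℝ, E) g →L[ℝ] ℝ :=
  differential 𝓘(ℝ, E) (fun h => L (h, ξ)) g

/-- The subset of `¹TT^*G` where `(¹Tπ_G)^* dL = θ₂`. -/
def lagrangianSet (L : G × E → ℝ) : Set (TulczyjewSpace E G) :=
  {p | pullbackForm (tulczyjewModel E) (𝓘(ℝ, E).prod 𝓘(ℝ, E)) tulczyjewProj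
    (differential (𝓘(ℝ, E).prod 𝓘(ℝ, E)) L) p = theta2 p}

variable (E G) in
/-- The tangent bundle `T(G × 𝔤^*)`. -/
abbrev CotangentTangent : Type _ :=
  TangentBundle (𝓘(ℝ, E).prod 𝓘(ℝ, StrongDual ℝ E)) (G × StrongDual ℝ E)

/-- The point `(g, μ; V_g, V_μ)` of `T(G × 𝔤^*)`. -/
def mkTangent (g : G) (μ : StrongDual ℝ E) (V : TangentSpace 𝓘(ℝ, E) g) (U : StrongDual ℝ E) :
    CotangentTangent E G :=
  ⟨(g, μ), show E × StrongDual ℝ E from (V, U)⟩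

/-- The trivialization `T(G × 𝔤^*) → ¹TT^*G`,
`(g, μ; V_g, V_μ) ↦ (g, μ, TR_{g⁻¹} V_g, V_μ - ad^*_{TR_{g⁻¹} V_g} μ)`. -/
def trivialization (X : CotangentTangent E G) : TulczyjewSpace E G :=
  let V : TangentSpace 𝓘(ℝ, E) X.proj.1 := (show E × StrongDual ℝ E from X.snd).1
  let U : StrongDual ℝ E := (show E × StrongDual ℝ E from X.snd).2
  (X.proj.1, X.proj.2, rightLower X.proj.1 V, U - adStar G (rightLower X.proj.1 V) X.proj.2)

/-- The reconstruction map `¹TT^*G → T(G × 𝔤^*)`, the inverse of the trivialization: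
`(g, μ, ξ, ν) ↦ (g, μ; TR_g ξ, ν + ad_ξ^* μ)`. -/
def reconstruction (p : TulczyjewSpace E G) : CotangentTangent E G :=
  mkTangent p.1 p.2.1 (rightLift p.1 p.2.2.1) (p.2.2.2 + adStar G p.2.2.1 p.2.1)

lemma trivialization_reconstruction [LieGroup 𝓘(ℝ, E) ∞ G] (p : TulczyjewSpace E G) :
    trivialization (reconstruction p) = p := by
  obtain ⟨g, μ, ξ, ν⟩ := p
  change (g, μ, rightLower g (rightLift g ξ),
    ν + adStar G ξ μ - adStar G (rightLower g (rightLift g ξ)) μ) = _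
  rw [rightLower_rightLift, add_sub_cancel_right]

lemma reconstruction_trivialization [LieGroup 𝓘(ℝ, E) ∞ G] (X : CotangentTangent E G) :
    reconstruction (trivialization X) = X := by
  obtain ⟨⟨g, μ⟩, V, U⟩ := X
  exact congrArg₂ (mkTangent g μ) (rightLift_rightLower g V)
    (sub_add_cancel (show StrongDual ℝ E from U) (adStar G (rightLower g V) μ))

/-- The tangent lift `t ↦ (γ t, γ' t)` of a curve in `G × 𝔤^*`. -/
def tangentLift (γ : ℝ → G × StrongDual ℝ E) (t : ℝ) : CotangentTangent E G :=
  ⟨γ t, mfderiv 𝓘(ℝ, ℝ) (𝓘(ℝ, E).prod 𝓘(ℝ, StrongDual ℝ E)) γ t (1 : ℝ)⟩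

/-- `ξ = TR_{g⁻¹} (dg/dt)`. -/
def trivVelocity (g : ℝ → G) (t : ℝ) : E :=
  rightLower (g t) (mfderiv 𝓘(ℝ, ℝ) 𝓘(ℝ, E) g t (1 : ℝ))

/-- On the open set `J` of times, the curve `g`, with `ξ = TR_{g⁻¹} (dg/dt)`, solves
the trivialized Euler-Lagrange equations
`d/dt (δL/δξ) = T_e^* R_g (δL/δg) + ad_ξ^* (δL/δξ)`. -/
def SolvesEulerLagrange (L : G × E → ℝ) (J : Set ℝ) (g : ℝ → G) : Prop :=
  ∀ t ∈ J, MDifferentiableAt 𝓘(ℝ, ℝ) 𝓘(ℝ, E) g t ∧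
    HasDerivAt (fun s => deltaXi L (g s) (trivVelocity g s))
      (rightDual (g t) (deltaG L (g t) (trivVelocity g t)) +
        adStar G (trivVelocity g t) (deltaXi L (g t) (trivVelocity g t))) t

end LieGroups

end

/-! Right translation identifies `¹TT^*G` with `T^*(G × 𝔤)`: the point `(g, μ, ξ, ν)` becomes the
covector `(ν ∘ TR_{g⁻¹}, μ)` at `(g, ξ)`. Under this identification `θ₂` is the canonical one-form
and `S` is the image of `dL`, so the theorem is the classical fact that the image of an exact
one-form is Lagrangian, carried out in charts.

Comparing coefficients of `V_g` and `V_ξ` shows that `S` is the graph of the section `σ = (δL/δξ,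
T_e^*R_g δL/δg)` over `G × 𝔤` (`mem_lagrangianSet_iff`). Subtracting `σ` from the fibre coordinates
straightens this graph into a linear subspace, which gives the slice charts
(`isSliceChart_shearChart`).

In a chart, `Ω` pairs `(V_μ, V_ν)` with `(V_ξ, V_g)`, plus a Maurer–Cartan term that involves only
the two `V_g` components (`tulczyjewForm_apply`). This triangular shape gives injectivity;
reflexivity gives surjectivity, since functionals of `V_μ` and `V_ν` must be evaluations at vectors
of `𝔤`.

Along `σ`, `θ₂` is the pullback of `dL`; hence `Ω` on `TS` is the antisymmetrized second derivative
of `L` in a chart, which is zero (`tulczyjewForm_sectionDeriv`). Conversely, a vector orthogonal to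
`TS` differs from a tangent one by a vertical vector, and the pairing kills the latter.

For curves, the trivialization turns membership in `S'` into `μ = δL/δξ` and `μ' - ad_ξ^* μ =
T_e^*R_g δL/δg`. -/

noncomputable section

/-! ### Smoothness of the Maurer–Cartan form and of the partial differentials of `L` -/

section LieGroups

variable {E G : Type*} [NormedAddCommGroup E] [NormedSpace ℝ E]
  [TopologicalSpace G] [ChartedSpace E G] [Group G]

/-- The right Maurer–Cartan form of `G`, read in the chart at `g₀`. -/
def maurerCartanInChart (g₀ : G) (y : E) : E →L[ℝ] E :=
  (show E →L[ℝ] E from rightLower ((extChartAt 𝓘(ℝ, E) g₀).symm y)).comp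
    (show E →L[ℝ] E from mfderiv 𝓘(ℝ, E) 𝓘(ℝ, E) (extChartAt 𝓘(ℝ, E) g₀).symm y)

lemma mfderiv_extChartAt_symm_self {M : Type*} [TopologicalSpace M] [ChartedSpace E M]
    [IsManifold 𝓘(ℝ, E) 1 M] (x : M) :
    mfderiv 𝓘(ℝ, E) 𝓘(ℝ, E) (extChartAt 𝓘(ℝ, E) x).symm (extChartAt 𝓘(ℝ, E) x x) =
      ContinuousLinearMap.id ℝ E := by
  have := mfderivWithin_range_extChartAt_symm (I := 𝓘(ℝ, E)) (x := x)
  rwa [ModelWithCorners.range_eq_univ, mfderivWithin_univ] at this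

lemma mdifferentiableAt_extChartAt_symm {M : Type*} [TopologicalSpace M] [ChartedSpace E M]
    [IsManifold 𝓘(ℝ, E) 1 M] {x : M} {y : E} (hy : y ∈ (extChartAt 𝓘(ℝ, E) x).target) :
    MDifferentiableAt 𝓘(ℝ, E) 𝓘(ℝ, E) (extChartAt 𝓘(ℝ, E) x).symm y := by
  have := mdifferentiableWithinAt_extChartAt_symm (I := 𝓘(ℝ, E)) hy
  rwa [ModelWithCorners.range_eq_univ, mdifferentiableWithinAt_univ] at this

lemma maurerCartanInChart_self [LieGroup 𝓘(ℝ, E) ∞ G] (g₀ : G) :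
    maurerCartanInChart g₀ (extChartAt 𝓘(ℝ, E) g₀ g₀) = rightLower g₀ := by
  have : IsManifold 𝓘(ℝ, E) 1 G := .of_le (n := ∞) (by simp)
  rw [maurerCartanInChart, mfderiv_extChartAt_symm_self, extChartAt_to_inv]
  rfl

/-- The map `(g, x) ↦ x g⁻¹` is jointly smooth, so its partial derivative in `x`, taken at `x = g`,
is smooth in `g` in tangent coordinates. These coordinates are the inverse chart on the source side
and trivial on the target side, where the value is always `1`. -/
lemma contDiffAt_maurerCartanInChart [LieGroup 𝓘(ℝ, E) ∞ G] (g₀ : G) :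
    ContDiffAt ℝ ∞ (maurerCartanInChart g₀) (extChartAt 𝓘(ℝ, E) g₀ g₀) := by
  have : IsManifold 𝓘(ℝ, E) 1 G := .of_le (n := ∞) (by simp)
  have hf : ContMDiff (𝓘(ℝ, E).prod 𝓘(ℝ, E)) 𝓘(ℝ, E) ∞
      (Function.uncurry fun g x : G => x * g⁻¹) := by
    have h1 : ContMDiff (𝓘(ℝ, E).prod 𝓘(ℝ, E)) 𝓘(ℝ, E) ∞ (fun p : G × G => p.1⁻¹) :=
      contMDiff_fst.inv
    exact contMDiff_snd.mul h1
  have h := ContMDiffAt.mfderiv (I := 𝓘(ℝ, E)) (I' := 𝓘(ℝ, E)) (J := 𝓘(ℝ, E)) (x₀ := g₀)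
    (m := ∞) (n := ∞)
    (fun g x : G => x * g⁻¹) id (hf _) contMDiffAt_id (by simp)
  have hs : ContMDiffAt 𝓘(ℝ, E) 𝓘(ℝ, E) ∞ (extChartAt 𝓘(ℝ, E) g₀).symm
      (extChartAt 𝓘(ℝ, E) g₀ g₀) :=
    (contMDiffOn_extChartAt_symm (I := 𝓘(ℝ, E)) (n := ∞) g₀).contMDiffAt
      (extChartAt_target_mem_nhds (I := 𝓘(ℝ, E)) g₀)
  have hc := ContMDiffAt.comp_of_eq h hs (extChartAt_to_inv (I := 𝓘(ℝ, E)) g₀)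
  refine hc.contDiffAt.congr_of_eventuallyEq ?_
  filter_upwards [extChartAt_target_mem_nhds (I := 𝓘(ℝ, E)) g₀] with y hy
  have hy' := (extChartAt 𝓘(ℝ, E) g₀).map_target hy
  rw [extChartAt_source] at hy'
  refine Eq.trans ?_ (inTangentCoordinates_eq_mfderiv_comp (I := 𝓘(ℝ, E)) (I' := 𝓘(ℝ, E))
    (f := id) (g := fun x : G => x * x⁻¹) (x₀ := g₀)
    (by simpa using hy') (by simp)).symm
  rw [ModelWithCorners.range_eq_univ, mfderivWithin_univ, id, id,
    (extChartAt 𝓘(ℝ, E) g₀).right_inv hy]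
  -- The points `g₀ g₀⁻¹` and `x x⁻¹` equal `1` only propositionally; generalizing them allows
  -- substitution inside the dependent types.
  have key : ∀ a b : G, a = 1 → b = 1 → ∀ B : E →L[ℝ] E, B =
      (show E →L[ℝ] E from mfderiv 𝓘(ℝ, E) 𝓘(ℝ, E) (extChartAt 𝓘(ℝ, E) a) b).comp B := by
    rintro _ _ rfl rfl B
    rw [mfderiv_extChartAt_self]
    rfl
  exact key _ _ (by simp) (by simp) _

lemma contMDiff_deltaXi [LieGroup 𝓘(ℝ, E) ∞ G] {L : G × E → ℝ}
    (hL : ContMDiff (𝓘(ℝ, E).prod 𝓘(ℝ, E)) 𝓘(ℝ, ℝ) ∞ L) :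
    ContMDiff (𝓘(ℝ, E).prod 𝓘(ℝ, E)) 𝓘(ℝ, StrongDual ℝ E) ∞
      (fun p : G × E => deltaXi L p.1 p.2) := by
  have : IsManifold 𝓘(ℝ, E) 1 G := .of_le (n := ∞) (by simp)
  intro p
  have hf : ContMDiff ((𝓘(ℝ, E).prod 𝓘(ℝ, E)).prod 𝓘(ℝ, E)) 𝓘(ℝ, ℝ) ∞
      (Function.uncurry fun (q : G × E) (η : E) => L (q.1, η)) :=
    hL.comp ((contMDiff_fst.comp contMDiff_fst).prodMk contMDiff_snd)
  have h := ContMDiffAt.mfderiv (I := 𝓘(ℝ, E)) (I' := 𝓘(ℝ, ℝ)) (J := 𝓘(ℝ, E).prod 𝓘(ℝ, E))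
    (x₀ := p) (m := ∞) (n := ∞) (fun (q : G × E) (η : E) => L (q.1, η)) Prod.snd (hf _)
    contMDiffAt_snd (by simp)
  refine h.congr_of_eventuallyEq (.of_forall fun q => ?_)
  refine Eq.trans ?_ (congrFun (inTangentCoordinates_model_space (I := 𝓘(ℝ, E))
    (I' := 𝓘(ℝ, ℝ)) Prod.snd (fun q : G × E => L (q.1, q.2)) _ p) q).symm
  exact mfderiv_eq_fderiv.symm

/-- By the chain rule, the differentiation point moves from the variable `g` to the fixed point `1`.
Smoothness in `(g, ξ)` then needs no varying tangent coordinates on `G`. -/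
lemma rightDual_deltaG [LieGroup 𝓘(ℝ, E) ∞ G] {L : G × E → ℝ}
    (hL : ContMDiff (𝓘(ℝ, E).prod 𝓘(ℝ, E)) 𝓘(ℝ, ℝ) ∞ L) (g : G) (ξ : E) :
    rightDual g (deltaG L g ξ) =
      mfderiv 𝓘(ℝ, E) 𝓘(ℝ, ℝ) (fun h : G => L (h * g, ξ)) 1 := by
  have hl : MDifferentiableAt 𝓘(ℝ, E) 𝓘(ℝ, E) (fun x : G => x * g) 1 :=
    (contMDiff_mul_right (I := 𝓘(ℝ, E)) (n := ∞)).contMDiffAt.mdifferentiableAt (by simp)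
  have hr : MDifferentiableAt 𝓘(ℝ, E) 𝓘(ℝ, ℝ) (fun x : G => L (x, ξ)) g :=
    (hL.comp (contMDiff_id.prodMk contMDiff_const)).contMDiffAt.mdifferentiableAt (by simp)
  have key : ∀ a : G, a = g → ∀ B : E →L[ℝ] E,
      (show E →L[ℝ] ℝ from mfderiv 𝓘(ℝ, E) 𝓘(ℝ, ℝ) (fun x : G => L (x, ξ)) g).comp B =
      (show E →L[ℝ] ℝ from mfderiv 𝓘(ℝ, E) 𝓘(ℝ, ℝ) (fun x : G => L (x, ξ)) a).comp B := by
    rintro _ rfl B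
    rfl
  exact (key _ (one_mul g) _).trans (mfderiv_comp_of_eq (x := (1 : G)) hr hl (one_mul g)).symm

lemma contMDiff_rightDual_deltaG [LieGroup 𝓘(ℝ, E) ∞ G] {L : G × E → ℝ}
    (hL : ContMDiff (𝓘(ℝ, E).prod 𝓘(ℝ, E)) 𝓘(ℝ, ℝ) ∞ L) :
    ContMDiff (𝓘(ℝ, E).prod 𝓘(ℝ, E)) 𝓘(ℝ, StrongDual ℝ E) ∞
      (fun p : G × E => rightDual p.1 (deltaG L p.1 p.2)) := by
  have : IsManifold 𝓘(ℝ, E) 1 G := .of_le (n := ∞) (by simp)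
  intro p
  have hf : ContMDiff ((𝓘(ℝ, E).prod 𝓘(ℝ, E)).prod 𝓘(ℝ, E)) 𝓘(ℝ, ℝ) ∞
      (Function.uncurry fun (q : G × E) (h : G) => L (h * q.1, q.2)) :=
    hL.comp ((contMDiff_snd.mul (contMDiff_fst.comp contMDiff_fst)).prodMk
      (contMDiff_snd.comp contMDiff_fst))
  have h := ContMDiffAt.mfderiv (I := 𝓘(ℝ, E)) (I' := 𝓘(ℝ, ℝ)) (J := 𝓘(ℝ, E).prod 𝓘(ℝ, E))
    (x₀ := p) (m := ∞) (n := ∞) (fun (q : G × E) (h : G) => L (h * q.1, q.2)) (fun _ => 1) (hf _)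
    contMDiffAt_const (by simp)
  refine h.congr_of_eventuallyEq (.of_forall fun q => ?_)
  refine Eq.trans ?_ (inTangentCoordinates_eq_mfderiv_comp (I := 𝓘(ℝ, E)) (I' := 𝓘(ℝ, ℝ))
    (f := fun _ => (1 : G)) (g := fun q : G × E => L (1 * q.1, q.2)) (x₀ := p)
    (by simp) (by rw [chartAt_self_eq]; trivial)).symm
  refine (rightDual_deltaG hL q.1 q.2).trans ?_
  rw [ModelWithCorners.range_eq_univ, mfderivWithin_univ, mfderiv_extChartAt_symm_self,
    extChartAt_model_space_eq_id]
  change _ = (mfderiv 𝓘(ℝ, ℝ) 𝓘(ℝ, ℝ) (id : ℝ → ℝ) _).comp _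
  rw [mfderiv_id]
  rfl

end LieGroups

/-! ### The equations of `S` and the Euler–Lagrange curves -/

section LieGroups

variable {E G : Type*} [NormedAddCommGroup E] [NormedSpace ℝ E]
  [TopologicalSpace G] [ChartedSpace E G]

variable (E) in
/-- The linear projection `(V_g, V_μ, V_ξ, V_ν) ↦ (V_g, V_ξ)`. -/
def tulczyjewProjL : E × TulczyjewFibre E →L[ℝ] E × E :=
  (ContinuousLinearMap.fst ℝ E (TulczyjewFibre E)).prod
    (((ContinuousLinearMap.fst ℝ E (StrongDual ℝ E)).comp
        (ContinuousLinearMap.snd ℝ (StrongDual ℝ E) (E × StrongDual ℝ E))).comp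
          (ContinuousLinearMap.snd ℝ E (TulczyjewFibre E)))

lemma hasMFDerivAt_tulczyjewProj (p : TulczyjewSpace E G) :
    HasMFDerivAt (tulczyjewModel E) (𝓘(ℝ, E).prod 𝓘(ℝ, E)) tulczyjewProj p
      (tulczyjewProjL E) := by
  have h1 := hasMFDerivAt_fst (I := 𝓘(ℝ, E)) (I' := 𝓘(ℝ, TulczyjewFibre E)) (x := p)
  have h2 := hasMFDerivAt_snd (I := 𝓘(ℝ, E)) (I' := 𝓘(ℝ, TulczyjewFibre E)) (x := p)
  exact h1.prodMk ((((ContinuousLinearMap.fst ℝ E (StrongDual ℝ E)).comp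
    (ContinuousLinearMap.snd ℝ (StrongDual ℝ E) (E × StrongDual ℝ E))).hasMFDerivAt).comp p h2)

lemma differential_apply {L : G × E → ℝ}
    (hL : ContMDiff (𝓘(ℝ, E).prod 𝓘(ℝ, E)) 𝓘(ℝ, ℝ) ∞ L) (q : G × E) (v : E × E) :
    differential (𝓘(ℝ, E).prod 𝓘(ℝ, E)) L q v =
      (show E →L[ℝ] ℝ from deltaG L q.1 q.2) v.1 + deltaXi L q.1 q.2 v.2 := by
  refine (mfderiv_prod_eq_add_apply (hL.contMDiffAt.mdifferentiableAt (by simp))).trans ?_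
  rw [mfderiv_eq_fderiv (f := fun z => L (q.1, z))]
  rfl

variable [Group G]

/-- Both one-forms ignore `V_μ` and `V_ν`, so testing on pure `V_ξ` vectors and on `V_g = TR_g η`
suffices; the converse uses that `TR_g` inverts `TR_{g⁻¹}`. -/
lemma mem_lagrangianSet_iff [LieGroup 𝓘(ℝ, E) ∞ G] {L : G × E → ℝ}
    (hL : ContMDiff (𝓘(ℝ, E).prod 𝓘(ℝ, E)) 𝓘(ℝ, ℝ) ∞ L) (p : TulczyjewSpace E G) :
    p ∈ lagrangianSet L ↔ p.2.1 = deltaXi L p.1 p.2.2.1 ∧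
      p.2.2.2 = rightDual p.1 (deltaG L p.1 p.2.2.1) := by
  obtain ⟨g, μ, ξ, ν⟩ := p
  have e : ∀ w : E × TulczyjewFibre E,
      pullbackForm (tulczyjewModel E) (𝓘(ℝ, E).prod 𝓘(ℝ, E)) tulczyjewProj
        (differential (𝓘(ℝ, E).prod 𝓘(ℝ, E)) L) (g, μ, ξ, ν) w =
      (show E →L[ℝ] ℝ from deltaG L g ξ) w.1 + deltaXi L g ξ w.2.2.1 := by
    intro w
    rw [pullbackForm, (hasMFDerivAt_tulczyjewProj _).mfderiv]
    exact differential_apply hL (g, ξ) (w.1, w.2.2.1)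
  have e' : ∀ w : E × TulczyjewFibre E, theta2 (g, μ, ξ, ν) w =
      ν ((show E →L[ℝ] E from rightLower g) w.1) + μ w.2.2.1 := fun w => rfl
  constructor
  · intro h
    have h' : ∀ w : E × TulczyjewFibre E, (show E →L[ℝ] ℝ from deltaG L g ξ) w.1 +
        deltaXi L g ξ w.2.2.1 = ν ((show E →L[ℝ] E from rightLower g) w.1) + μ w.2.2.1 := by
      intro w
      rw [← e, ← e']
      exact DFunLike.congr_fun h w
    constructor
    · ext η
      have h1 := (h' (0, 0, η, 0)).symm
      rwa [map_zero, map_zero, map_zero, zero_add, zero_add] at h1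
    · ext η
      have h1 := (h' (rightLift g η, 0, 0, 0)).symm
      have h2 : (show E →L[ℝ] E from rightLower g) (rightLift g η) = η :=
        rightLower_rightLift g η
      rw [h2] at h1
      rwa [map_zero, map_zero, add_zero, add_zero] at h1
  · rintro ⟨h1, h2⟩
    change μ = _ at h1
    change ν = _ at h2
    refine ContinuousLinearMap.ext fun w => ?_
    refine (e w).trans ((e' w).trans ?_).symm
    rw [h1, h2]
    congr 1
    exact congrArg (deltaG L g ξ)
      (rightLift_rightLower g (show E × TulczyjewFibre E from w).1)

lemma lagrangianSet_eq [LieGroup 𝓘(ℝ, E) ∞ G] {L : G × E → ℝ}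
    (hL : ContMDiff (𝓘(ℝ, E).prod 𝓘(ℝ, E)) 𝓘(ℝ, ℝ) ∞ L) :
    lagrangianSet L = {p : TulczyjewSpace E G | ∃ (g : G) (ξ : E),
      p = (g, deltaXi L g ξ, ξ, rightDual g (deltaG L g ξ))} := by
  ext p
  rw [mem_lagrangianSet_iff hL]
  constructor
  · rintro ⟨h1, h2⟩
    obtain ⟨g, μ, ξ, ν⟩ := p
    exact ⟨g, ξ, by simp only at h1 h2; rw [← h1, ← h2]⟩
  · rintro ⟨g, ξ, rfl⟩
    exact ⟨rfl, rfl⟩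

lemma reconstruction_image_lagrangianSet [LieGroup 𝓘(ℝ, E) ∞ G] {L : G × E → ℝ}
    (hL : ContMDiff (𝓘(ℝ, E).prod 𝓘(ℝ, E)) 𝓘(ℝ, ℝ) ∞ L) :
    reconstruction '' lagrangianSet L = {X : CotangentTangent E G | ∃ (g : G) (ξ : E),
      X = mkTangent g (deltaXi L g ξ) (rightLift g ξ)
        (rightDual g (deltaG L g ξ) + adStar G ξ (deltaXi L g ξ))} := by
  rw [lagrangianSet_eq hL]
  ext X
  constructor
  · rintro ⟨_, ⟨g, ξ, rfl⟩, rfl⟩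
    exact ⟨g, ξ, rfl⟩
  · rintro ⟨g, ξ, rfl⟩
    exact ⟨_, ⟨g, ξ, rfl⟩, rfl⟩

lemma mem_reconstruction_image_iff [LieGroup 𝓘(ℝ, E) ∞ G] {L : G × E → ℝ}
    (X : CotangentTangent E G) :
    X ∈ reconstruction '' lagrangianSet L ↔ trivialization X ∈ lagrangianSet L := by
  constructor
  · rintro ⟨p, hp, rfl⟩
    rwa [trivialization_reconstruction]
  · exact fun h => ⟨_, h, reconstruction_trivialization X⟩

/-- The trivialization sends the tangent lift to `(g, μ, ξ, μ' - ad_ξ^* μ)`, to which the equations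
of `S` apply. -/
lemma tangentLift_mem_iff [LieGroup 𝓘(ℝ, E) ∞ G] {L : G × E → ℝ}
    (hL : ContMDiff (𝓘(ℝ, E).prod 𝓘(ℝ, E)) 𝓘(ℝ, ℝ) ∞ L) {g : ℝ → G} {μ : ℝ → StrongDual ℝ E}
    {t : ℝ} (hg : MDifferentiableAt 𝓘(ℝ, ℝ) 𝓘(ℝ, E) g t) (hμ : DifferentiableAt ℝ μ t) :
    tangentLift (fun s => (g s, μ s)) t ∈ reconstruction '' lagrangianSet L ↔
      μ t = deltaXi L (g t) (trivVelocity g t) ∧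
      deriv μ t = rightDual (g t) (deltaG L (g t) (trivVelocity g t)) +
        adStar G (trivVelocity g t) (deltaXi L (g t) (trivVelocity g t)) := by
  have e : trivialization (tangentLift (fun s => (g s, μ s)) t) =
      (g t, μ t, trivVelocity g t, deriv μ t - adStar G (trivVelocity g t) (μ t)) := by
    rw [tangentLift, mfderiv_prodMk hg hμ.mdifferentiableAt,
      mfderiv_eq_fderiv (f := μ)]
    rfl
  rw [mem_reconstruction_image_iff, e, mem_lagrangianSet_iff hL]
  change μ t = _ ∧ deriv μ t - _ = _ ↔ _
  refine and_congr_right fun h => ?_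
  rw [← h, sub_eq_iff_eq_add]

lemma tangentLift_mem_iff_solvesEulerLagrange [LieGroup 𝓘(ℝ, E) ∞ G] {L : G × E → ℝ}
    (hL : ContMDiff (𝓘(ℝ, E).prod 𝓘(ℝ, E)) 𝓘(ℝ, ℝ) ∞ L) {J : Set ℝ} (hJ : IsOpen J)
    (g : ℝ → G) (μ : ℝ → StrongDual ℝ E) :
    (∀ t ∈ J,
        MDifferentiableAt 𝓘(ℝ, ℝ) (𝓘(ℝ, E).prod 𝓘(ℝ, StrongDual ℝ E)) (fun s => (g s, μ s)) t ∧
        tangentLift (fun s => (g s, μ s)) t ∈ reconstruction '' lagrangianSet L) ↔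
      (SolvesEulerLagrange L J g ∧ ∀ t ∈ J, μ t = deltaXi L (g t) (trivVelocity g t)) := by
  -- Openness of `J` upgrades the pointwise equality to equality of germs, so differentiability
  -- passes between `μ` and `δL/δξ` in both directions.
  have ev : (∀ t ∈ J, μ t = deltaXi L (g t) (trivVelocity g t)) → ∀ t ∈ J,
      μ =ᶠ[nhds t] fun s => deltaXi L (g s) (trivVelocity g s) := fun h t ht =>
    Filter.eventuallyEq_of_mem (hJ.mem_nhds ht) h
  constructor
  · intro h
    have hg : ∀ t ∈ J, MDifferentiableAt 𝓘(ℝ, ℝ) 𝓘(ℝ, E) g t := fun t ht => (h t ht).1.fst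
    have hμ : ∀ t ∈ J, DifferentiableAt ℝ μ t := fun t ht =>
      mdifferentiableAt_iff_differentiableAt.1 (h t ht).1.snd
    have hS := fun t ht => (tangentLift_mem_iff hL (hg t ht) (hμ t ht)).1 (h t ht).2
    have hμe : ∀ t ∈ J, μ t = deltaXi L (g t) (trivVelocity g t) := fun t ht => (hS t ht).1
    refine ⟨fun t ht => ⟨hg t ht, ?_⟩, hμe⟩
    rw [← (hS t ht).2]
    exact (hμ t ht).hasDerivAt.congr_of_eventuallyEq (ev hμe t ht).symm
  · rintro ⟨h, hμe⟩ t ht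
    obtain ⟨hg, hd⟩ := h t ht
    have hμ := hd.congr_of_eventuallyEq (ev hμe t ht)
    exact ⟨hg.prodMk hμ.differentiableAt.mdifferentiableAt,
      (tangentLift_mem_iff hL hg hμ.differentiableAt).2 ⟨hμe t ht, hμ.deriv⟩⟩

end LieGroups

/-! ### `Ω` in a chart and its non-degeneracy -/

section LieGroups

variable {E G : Type*} [NormedAddCommGroup E] [NormedSpace ℝ E]
  [TopologicalSpace G] [ChartedSpace E G]

lemma extChartAt_tulczyjewSpace_apply (p q : TulczyjewSpace E G) :
    extChartAt (tulczyjewModel E) p q = (extChartAt 𝓘(ℝ, E) p.1 q.1, q.2) := by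
  rw [extChartAt_prod, extChartAt_model_space_eq_id]
  rfl

lemma extChartAt_tulczyjewSpace_symm (p : TulczyjewSpace E G) :
    ((extChartAt (tulczyjewModel E) p).symm : E × TulczyjewFibre E → TulczyjewSpace E G) =
      Prod.map (extChartAt 𝓘(ℝ, E) p.1).symm id := by
  rw [extChartAt_prod, extChartAt_model_space_eq_id]
  rfl

lemma hasMFDerivAt_extChartAt_tulczyjewSpace_symm [IsManifold 𝓘(ℝ, E) 1 G] (p : TulczyjewSpace E G)
    {y : E × TulczyjewFibre E} (hy : y.1 ∈ (extChartAt 𝓘(ℝ, E) p.1).target) :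
    HasMFDerivAt 𝓘(ℝ, E × TulczyjewFibre E) (tulczyjewModel E)
      (extChartAt (tulczyjewModel E) p).symm y
      ((show E →L[ℝ] E from
        mfderiv 𝓘(ℝ, E) 𝓘(ℝ, E) (extChartAt 𝓘(ℝ, E) p.1).symm y.1).prodMap
        (ContinuousLinearMap.id ℝ (TulczyjewFibre E))) := by
  rw [extChartAt_tulczyjewSpace_symm]
  have h1 := (mdifferentiableAt_extChartAt_symm hy).hasMFDerivAt.comp y
    (ContinuousLinearMap.fst ℝ E (TulczyjewFibre E)).hasMFDerivAt
  exact h1.prodMk (ContinuousLinearMap.snd ℝ E (TulczyjewFibre E)).hasMFDerivAt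

lemma eventually_fst_mem_target (p : TulczyjewSpace E G) :
    ∀ᶠ y in nhds (extChartAt (tulczyjewModel E) p p),
      y.1 ∈ (extChartAt 𝓘(ℝ, E) p.1).target := by
  rw [extChartAt_tulczyjewSpace_apply]
  exact continuous_fst.continuousAt.preimage_mem_nhds
    (extChartAt_target_mem_nhds (I := 𝓘(ℝ, E)) p.1)

variable [Group G]

/-- The expression of `θ₂` in the chart at a point over `g₀`. -/
def theta2InChart (g₀ : G) (y : E × TulczyjewFibre E) : E × TulczyjewFibre E →L[ℝ] ℝ :=
  (y.2.2.2.comp (maurerCartanInChart g₀ y.1)).comp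
      ((ContinuousLinearMap.fst ℝ E E).comp (tulczyjewProjL E)) +
    y.2.1.comp ((ContinuousLinearMap.snd ℝ E E).comp (tulczyjewProjL E))

lemma formInChart_theta2 [IsManifold 𝓘(ℝ, E) 1 G] (p : TulczyjewSpace E G)
    {y : E × TulczyjewFibre E} (hy : y.1 ∈ (extChartAt 𝓘(ℝ, E) p.1).target) :
    formInChart (tulczyjewModel E) theta2 p y = theta2InChart p.1 y := by
  have h := (hasMFDerivAt_extChartAt_tulczyjewSpace_symm p hy).mfderiv
  refine ContinuousLinearMap.ext fun v => ?_
  rw [formInChart, pullbackForm, h, extChartAt_tulczyjewSpace_symm]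
  rfl

lemma contDiffAt_theta2InChart [LieGroup 𝓘(ℝ, E) ∞ G] (p : TulczyjewSpace E G) :
    ContDiffAt ℝ ∞ (theta2InChart p.1) (extChartAt (tulczyjewModel E) p p) := by
  rw [extChartAt_tulczyjewSpace_apply]
  have hA : ContDiffAt ℝ ∞ (fun y : E × TulczyjewFibre E => maurerCartanInChart p.1 y.1)
      (extChartAt 𝓘(ℝ, E) p.1 p.1, p.2) :=
    (contDiffAt_maurerCartanInChart p.1).comp (extChartAt 𝓘(ℝ, E) p.1 p.1, p.2) contDiffAt_fst
  have hν : ContDiff ℝ ∞ (fun y : E × TulczyjewFibre E => y.2.2.2) := by fun_prop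
  have hμ : ContDiff ℝ ∞ (fun y : E × TulczyjewFibre E => y.2.1) := by fun_prop
  exact ((hν.contDiffAt.clm_comp hA).clm_comp contDiffAt_const).add
    (hμ.contDiffAt.clm_comp contDiffAt_const)

lemma tulczyjewForm_eq [IsManifold 𝓘(ℝ, E) 1 G] (p : TulczyjewSpace E G)
    (u v : E × TulczyjewFibre E) :
    tulczyjewForm p u v =
      fderiv ℝ (theta2InChart p.1) (extChartAt (tulczyjewModel E) p p) u v -
      fderiv ℝ (theta2InChart p.1) (extChartAt (tulczyjewModel E) p p) v u := by
  have h : formInChart (tulczyjewModel E) theta2 p =ᶠ[nhds (extChartAt (tulczyjewModel E) p p)]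
      theta2InChart p.1 :=
    (eventually_fst_mem_target p).mono fun y hy => formInChart_theta2 p hy
  rw [← h.fderiv_eq]
  rfl

lemma fderiv_theta2InChart_apply [LieGroup 𝓘(ℝ, E) ∞ G] (p : TulczyjewSpace E G)
    (u v : E × TulczyjewFibre E) :
    fderiv ℝ (theta2InChart p.1) (extChartAt (tulczyjewModel E) p p) u v =
      u.2.2.2 ((show E →L[ℝ] E from rightLower p.1) v.1) +
      p.2.2.2 (fderiv ℝ (maurerCartanInChart p.1) (extChartAt 𝓘(ℝ, E) p.1 p.1) u.1 v.1) +
      u.2.1 v.2.2.1 := by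
  -- With `v` fixed, the derivative of `y ↦ θ₂(y) v` is computed twice: from differentiability of
  -- the whole form, and by the product rule on `ν (A(y) V_g) + μ V_ξ`.
  have hθ := ((contDiffAt_theta2InChart p).differentiableAt (by simp)).hasFDerivAt
  have h1 := hθ.clm_apply (hasFDerivAt_const v _)
  have hA := ((contDiffAt_maurerCartanInChart (E := E) p.1).differentiableAt (by simp)).hasFDerivAt
  have hA' : HasFDerivAt (fun y : E × TulczyjewFibre E => maurerCartanInChart p.1 y.1)
      ((fderiv ℝ (maurerCartanInChart p.1) (extChartAt 𝓘(ℝ, E) p.1 p.1)).comp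
        (ContinuousLinearMap.fst ℝ E (TulczyjewFibre E)))
      (extChartAt (tulczyjewModel E) p p) := by
    rw [extChartAt_tulczyjewSpace_apply]
    exact HasFDerivAt.comp (f := (Prod.fst : E × TulczyjewFibre E → E))
      (extChartAt 𝓘(ℝ, E) p.1 p.1, p.2) hA hasFDerivAt_fst
  have hν := (((ContinuousLinearMap.snd ℝ E (StrongDual ℝ E)).comp
    (ContinuousLinearMap.snd ℝ (StrongDual ℝ E) (E × StrongDual ℝ E))).comp
      (ContinuousLinearMap.snd ℝ E (TulczyjewFibre E))).hasFDerivAt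
        (x := extChartAt (tulczyjewModel E) p p)
  have hμ := ((ContinuousLinearMap.fst ℝ (StrongDual ℝ E) (E × StrongDual ℝ E)).comp
    (ContinuousLinearMap.snd ℝ E (TulczyjewFibre E))).hasFDerivAt
      (x := extChartAt (tulczyjewModel E) p p)
  have h2 := (hν.clm_apply (hA'.clm_apply (hasFDerivAt_const v.1 _))).add
    (hμ.clm_apply (hasFDerivAt_const v.2.2.1 _))
  have h3 := DFunLike.congr_fun (h1.unique h2) u
  obtain ⟨A, hA₀⟩ : ∃ A : E →L[ℝ] E, A = rightLower p.1 := ⟨_, rfl⟩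
  rw [← hA₀]
  simp only [extChartAt_tulczyjewSpace_apply, maurerCartanInChart_self, ← hA₀] at h3 ⊢
  simp [-extChartAt] at h3
  rw [h3]
  ring

lemma tulczyjewForm_apply [LieGroup 𝓘(ℝ, E) ∞ G] (p : TulczyjewSpace E G)
    (u v : E × TulczyjewFibre E) :
    tulczyjewForm p u v =
      u.2.2.2 ((show E →L[ℝ] E from rightLower p.1) v.1) + u.2.1 v.2.2.1 -
      (v.2.2.2 ((show E →L[ℝ] E from rightLower p.1) u.1) + v.2.1 u.2.2.1) +
      p.2.2.2 (fderiv ℝ (maurerCartanInChart p.1) (extChartAt 𝓘(ℝ, E) p.1 p.1) u.1 v.1 -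
        fderiv ℝ (maurerCartanInChart p.1) (extChartAt 𝓘(ℝ, E) p.1 p.1) v.1 u.1) := by
  have : IsManifold 𝓘(ℝ, E) 1 G := .of_le (n := ∞) (by simp)
  rw [tulczyjewForm_eq, fderiv_theta2InChart_apply, fderiv_theta2InChart_apply, map_sub]
  ring

/-- The system `Ω(u, ·) = ℓ` is triangular: the `V_μ`, `V_ν` and `V_ξ` slots determine `ξ`, `V` and
`μ`; then `ν` is found from the `V_g` slot, the only one containing the Maurer–Cartan term. -/
lemma tulczyjewForm_bijective [LieGroup 𝓘(ℝ, E) ∞ G]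
    (hE : Function.Surjective (NormedSpace.inclusionInDoubleDual ℝ E)) (p : TulczyjewSpace E G) :
    Function.Bijective (tulczyjewForm p) := by
  set A : E →L[ℝ] E := rightLower p.1
  set B : E →L[ℝ] E := rightLift p.1
  have hAB : ∀ ξ, A (B ξ) = ξ := rightLower_rightLift p.1
  have hBA : ∀ V, B (A V) = V := rightLift_rightLower p.1
  set D := fderiv ℝ (maurerCartanInChart p.1) (extChartAt 𝓘(ℝ, E) p.1 p.1)
  have hΩ : ∀ u v : E × TulczyjewFibre E, tulczyjewForm p u v =
      u.2.2.2 (A v.1) + u.2.1 v.2.2.1 - (v.2.2.2 (A u.1) + v.2.1 u.2.2.1) +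
        p.2.2.2 (D u.1 v.1 - D v.1 u.1) := tulczyjewForm_apply p
  constructor
  · refine (injective_iff_map_eq_zero (tulczyjewForm p)).2 fun u hu => ?_
    obtain ⟨V, μ, ξ, ν⟩ := u
    have h : ∀ v : E × TulczyjewFibre E, ν (A v.1) + μ v.2.2.1 - (v.2.2.2 (A V) + v.2.1 ξ) +
        p.2.2.2 (D V v.1 - D v.1 V) = 0 := fun v =>
      (hΩ (V, μ, ξ, ν) v).symm.trans (DFunLike.congr_fun hu v)
    have hV : A V = 0 := by
      refine SeparatingDual.eq_zero_of_forall_dual_eq_zero (R := ℝ) fun f => ?_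
      simpa using h (0, 0, 0, f)
    have hξ : ξ = 0 := by
      refine SeparatingDual.eq_zero_of_forall_dual_eq_zero (R := ℝ) fun f => ?_
      simpa using h (0, f, 0, 0)
    have hV' : V = 0 := by rw [← hBA V, hV, map_zero]
    have hμ : μ = 0 := by
      ext η
      simpa using h (0, 0, η, 0)
    have hν : ν = 0 := by
      ext η
      simpa [hV', hAB] using h (B η, 0, 0, 0)
    rw [hV', hξ, hμ, hν]
    rfl
  · intro ℓ'
    set ℓ : E × TulczyjewFibre E →L[ℝ] ℝ := ℓ'
    -- By reflexivity, the restrictions of `ℓ` to the two copies of `𝔤^*` are evaluations at vectors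
    -- `ξ` and `η`.
    obtain ⟨ξ, hξ⟩ := hE (ℓ.comp ((ContinuousLinearMap.inr ℝ E (TulczyjewFibre E)).comp
      (ContinuousLinearMap.inl ℝ (StrongDual ℝ E) (E × StrongDual ℝ E))))
    obtain ⟨η, hη⟩ := hE (ℓ.comp ((ContinuousLinearMap.inr ℝ E (TulczyjewFibre E)).comp
      ((ContinuousLinearMap.inr ℝ (StrongDual ℝ E) (E × StrongDual ℝ E)).comp
        (ContinuousLinearMap.inr ℝ E (StrongDual ℝ E)))))
    have hξ' : ∀ f : StrongDual ℝ E, f ξ = ℓ (0, f, 0, 0) := fun f => DFunLike.congr_fun hξ f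
    have hη' : ∀ f : StrongDual ℝ E, f η = ℓ (0, 0, 0, f) := fun f => DFunLike.congr_fun hη f
    set μ : StrongDual ℝ E := ℓ.comp ((ContinuousLinearMap.inr ℝ E (TulczyjewFibre E)).comp
      ((ContinuousLinearMap.inr ℝ (StrongDual ℝ E) (E × StrongDual ℝ E)).comp
        (ContinuousLinearMap.inl ℝ E (StrongDual ℝ E))))
    set κ : StrongDual ℝ E := ℓ.comp (ContinuousLinearMap.inl ℝ E (TulczyjewFibre E))
    -- The sign comes from the term `-ν'(A V)` of `Ω`. The next choice makes `ν` absorb the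
    -- Maurer–Cartan term, which is known once `V` is.
    set V := -B η
    set ν : StrongDual ℝ E := (κ - p.2.2.2.comp (D V - D.flip V)).comp B
    refine ⟨(show TangentSpace (tulczyjewModel E) p from
      ((V, μ, -ξ, ν) : E × TulczyjewFibre E)), ContinuousLinearMap.ext fun v => ?_⟩
    refine (hΩ (V, μ, -ξ, ν) v).trans ?_
    obtain ⟨V', μ', ξ', ν'⟩ := v
    change ν (A V') + μ ξ' - (ν' (A (-B η)) + μ' (-ξ)) + p.2.2.2 (D V V' - D V' V) =
      ℓ (V', μ', ξ', ν')
    have hν : ν (A V') = κ V' - p.2.2.2 (D V V' - D V' V) := by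
      change κ (B (A V')) - p.2.2.2 (D V (B (A V')) - D (B (A V')) V) = _
      rw [hBA]
    have hsum : ((V', μ', ξ', ν') : E × TulczyjewFibre E) =
        (V', 0, 0, 0) + (0, μ', 0, 0) + (0, 0, ξ', 0) + (0, 0, 0, ν') := by simp
    rw [hν, map_neg A, hAB, map_neg ν', map_neg μ', hη', hξ', hsum, map_add, map_add, map_add]
    change ℓ (V', 0, 0, 0) - _ + ℓ (0, 0, ξ', 0) - _ + _ = _
    ring

end LieGroups

/-! ### Slice charts for the graph of a section -/

section LieGroups

variable {E G : Type*} [NormedAddCommGroup E] [NormedSpace ℝ E]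
  [TopologicalSpace G]

variable (E) in
/-- The linear map `(V_g, V_μ, V_ξ, V_ν) ↦ (V_μ, V_ν)`. -/
def tulczyjewCoprojL : E × TulczyjewFibre E →L[ℝ] StrongDual ℝ E × StrongDual ℝ E :=
  ((ContinuousLinearMap.fst ℝ (StrongDual ℝ E) (E × StrongDual ℝ E)).prod
    ((ContinuousLinearMap.snd ℝ E (StrongDual ℝ E)).comp
      (ContinuousLinearMap.snd ℝ (StrongDual ℝ E) (E × StrongDual ℝ E)))).comp
        (ContinuousLinearMap.snd ℝ E (TulczyjewFibre E))

lemma closedComplemented_ker_tulczyjewCoprojL :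
    (tulczyjewCoprojL E).ker.ClosedComplemented :=
  ContinuousLinearMap.closedComplemented_ker_of_rightInverse (tulczyjewCoprojL E)
    ((ContinuousLinearMap.inr ℝ E (TulczyjewFibre E)).comp
      ((ContinuousLinearMap.fst ℝ (StrongDual ℝ E) (StrongDual ℝ E)).prod
        ((ContinuousLinearMap.inr ℝ E (StrongDual ℝ E)).comp
          (ContinuousLinearMap.snd ℝ (StrongDual ℝ E) (StrongDual ℝ E))))) fun _ => rfl

/-- The homeomorphism `(g, μ, ξ, ν) ↦ (g, μ - a, ξ, ν - b)`, where `(a, b) = σ (g, ξ)`. -/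
def verticalShear (σ : G × E → StrongDual ℝ E × StrongDual ℝ E) (hσ : Continuous σ) :
    TulczyjewSpace E G ≃ₜ TulczyjewSpace E G where
  toFun p := (p.1, p.2.1 - (σ (p.1, p.2.2.1)).1, p.2.2.1, p.2.2.2 - (σ (p.1, p.2.2.1)).2)
  invFun p := (p.1, p.2.1 + (σ (p.1, p.2.2.1)).1, p.2.2.1, p.2.2.2 + (σ (p.1, p.2.2.1)).2)
  left_inv p := by simp
  right_inv p := by simp
  continuous_toFun := by fun_prop
  continuous_invFun := by fun_prop

variable [ChartedSpace E G]

section Smooth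

variable {σ : G × E → StrongDual ℝ E × StrongDual ℝ E}

lemma contMDiff_tulczyjewProj :
    ContMDiff (tulczyjewModel E) (𝓘(ℝ, E).prod 𝓘(ℝ, E)) ∞
      (tulczyjewProj : TulczyjewSpace E G → G × E) :=
  contMDiff_fst.prodMk (((ContinuousLinearMap.fst ℝ E (StrongDual ℝ E)).comp
    (ContinuousLinearMap.snd ℝ (StrongDual ℝ E) (E × StrongDual ℝ E))).contMDiff.comp contMDiff_snd)

lemma contMDiff_tulczyjewSpace_mk {f : TulczyjewSpace E G → StrongDual ℝ E × StrongDual ℝ E}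
    (hf : ContMDiff (tulczyjewModel E) 𝓘(ℝ, StrongDual ℝ E × StrongDual ℝ E) ∞ f) :
    ContMDiff (tulczyjewModel E) (tulczyjewModel E) ∞
      (fun p : TulczyjewSpace E G => (p.1, (f p).1, p.2.2.1, (f p).2)) := by
  have h1 := (ContinuousLinearMap.fst ℝ (StrongDual ℝ E) (StrongDual ℝ E)).contMDiff.comp hf
  have h2 := (ContinuousLinearMap.snd ℝ (StrongDual ℝ E) (StrongDual ℝ E)).contMDiff.comp hf
  have h3 := contMDiff_snd.comp (contMDiff_tulczyjewProj (E := E) (G := G))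
  exact contMDiff_fst.prodMk (h1.prodMk_space (h3.prodMk_space h2))

lemma contMDiff_tulczyjewCoproj :
    ContMDiff (tulczyjewModel E) 𝓘(ℝ, StrongDual ℝ E × StrongDual ℝ E) ∞
      (fun p : TulczyjewSpace E G => (p.2.1, p.2.2.2)) :=
  (((ContinuousLinearMap.fst ℝ (StrongDual ℝ E) (E × StrongDual ℝ E)).prod
    ((ContinuousLinearMap.snd ℝ E (StrongDual ℝ E)).comp
      (ContinuousLinearMap.snd ℝ (StrongDual ℝ E) (E × StrongDual ℝ E)))).contMDiff).comp
        contMDiff_snd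

lemma contMDiff_verticalShear
    (hσ : ContMDiff (𝓘(ℝ, E).prod 𝓘(ℝ, E)) 𝓘(ℝ, StrongDual ℝ E × StrongDual ℝ E) ∞ σ) :
    ContMDiff (tulczyjewModel E) (tulczyjewModel E) ∞ (verticalShear σ hσ.continuous) :=
  contMDiff_tulczyjewSpace_mk
    (contMDiff_tulczyjewCoproj.sub (hσ.comp contMDiff_tulczyjewProj))

lemma contMDiff_verticalShear_symm
    (hσ : ContMDiff (𝓘(ℝ, E).prod 𝓘(ℝ, E)) 𝓘(ℝ, StrongDual ℝ E × StrongDual ℝ E) ∞ σ) :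
    ContMDiff (tulczyjewModel E) (tulczyjewModel E) ∞ (verticalShear σ hσ.continuous).symm :=
  contMDiff_tulczyjewSpace_mk
    (contMDiff_tulczyjewCoproj.add (hσ.comp contMDiff_tulczyjewProj))

/-- The chart around `p` which flattens the graph of `σ`. -/
def shearChart
    (hσ : ContMDiff (𝓘(ℝ, E).prod 𝓘(ℝ, E)) 𝓘(ℝ, StrongDual ℝ E × StrongDual ℝ E) ∞ σ)
    (p : TulczyjewSpace E G) :
    OpenPartialHomeomorph (TulczyjewSpace E G) (ModelProd E (TulczyjewFibre E)) :=
  (verticalShear σ hσ.continuous).transOpenPartialHomeomorph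
    (chartAt (ModelProd E (TulczyjewFibre E)) p)

/-- The shear is a diffeomorphism, its inverse being the shear by `-σ`, and a chart precomposed with
a diffeomorphism is a chart. -/
lemma shearChart_mem_maximalAtlas [IsManifold 𝓘(ℝ, E) ∞ G]
    (hσ : ContMDiff (𝓘(ℝ, E).prod 𝓘(ℝ, E)) 𝓘(ℝ, StrongDual ℝ E × StrongDual ℝ E) ∞ σ)
    (p : TulczyjewSpace E G) :
    shearChart hσ p ∈ IsManifold.maximalAtlas (tulczyjewModel E) ∞ (TulczyjewSpace E G) := by
  refine (IsManifold.mem_maximalAtlas_iff_contMDiffOn _).2 ⟨?_, ?_⟩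
  · exact (contMDiffOn_chart (I := tulczyjewModel E) (x := p)).comp
      (contMDiff_verticalShear hσ).contMDiffOn fun q hq => hq
  · exact (contMDiff_verticalShear_symm hσ).comp_contMDiffOn
      (contMDiffOn_chart_symm (I := tulczyjewModel E) (x := p))

lemma mem_shearChart_source
    (hσ : ContMDiff (𝓘(ℝ, E).prod 𝓘(ℝ, E)) 𝓘(ℝ, StrongDual ℝ E × StrongDual ℝ E) ∞ σ)
    (p : TulczyjewSpace E G) : p ∈ (shearChart hσ p).source :=
  ⟨mem_chart_source E p.1, trivial⟩

lemma tulczyjewCoprojL_shearChart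
    (hσ : ContMDiff (𝓘(ℝ, E).prod 𝓘(ℝ, E)) 𝓘(ℝ, StrongDual ℝ E × StrongDual ℝ E) ∞ σ)
    (p q : TulczyjewSpace E G) :
    tulczyjewCoprojL E ((shearChart hσ p).extend (tulczyjewModel E) q) =
      (q.2.1, q.2.2.2) - σ (tulczyjewProj q) := rfl

lemma isSliceChart_shearChart [IsManifold 𝓘(ℝ, E) ∞ G]
    (hσ : ContMDiff (𝓘(ℝ, E).prod 𝓘(ℝ, E)) 𝓘(ℝ, StrongDual ℝ E × StrongDual ℝ E) ∞ σ)
    (p : TulczyjewSpace E G) :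
    IsSliceChart (tulczyjewModel E) {q : TulczyjewSpace E G | (q.2.1, q.2.2.2) = σ (tulczyjewProj q)}
      p (shearChart hσ p) (tulczyjewCoprojL E).ker where
  mem_atlas := shearChart_mem_maximalAtlas hσ p
  mem_source := mem_shearChart_source hσ p
  complemented := closedComplemented_ker_tulczyjewCoprojL
  slice q _ := by
    rw [LinearMap.mem_ker]
    refine Iff.trans ?_ (Eq.congr_left (tulczyjewCoprojL_shearChart hσ p q)).symm
    exact sub_eq_zero.symm

/-- The tangent space of the graph of `σ` is the graph of `Tσ`: the `(μ, ν)` part of the chart is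
`(μ, ν) - σ(g, ξ)`, and this identity is differentiated. -/
lemma mfderiv_shearChart_mem_ker [IsManifold 𝓘(ℝ, E) ∞ G]
    (hσ : ContMDiff (𝓘(ℝ, E).prod 𝓘(ℝ, E)) 𝓘(ℝ, StrongDual ℝ E × StrongDual ℝ E) ∞ σ)
    (p : TulczyjewSpace E G) (v : E × TulczyjewFibre E) :
    (show E × TulczyjewFibre E from mfderiv (tulczyjewModel E) 𝓘(ℝ, E × TulczyjewFibre E)
      ((shearChart hσ p).extend (tulczyjewModel E)) p v) ∈ (tulczyjewCoprojL E).ker ↔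
      (v.2.1, v.2.2.2) = (show E × E →L[ℝ] StrongDual ℝ E × StrongDual ℝ E from
        mfderiv (𝓘(ℝ, E).prod 𝓘(ℝ, E)) 𝓘(ℝ, StrongDual ℝ E × StrongDual ℝ E) σ
          (tulczyjewProj p)) (tulczyjewProjL E v) := by
  have hd : MDifferentiableAt (tulczyjewModel E) 𝓘(ℝ, E × TulczyjewFibre E)
      ((shearChart hσ p).extend (tulczyjewModel E)) p :=
    (((shearChart hσ p).contMDiffOn_extend (shearChart_mem_maximalAtlas hσ p)).contMDiffAt
      ((shearChart hσ p).open_source.mem_nhds (mem_shearChart_source hσ p))).mdifferentiableAt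
        (by simp)
  have h1 := (tulczyjewCoprojL E).hasMFDerivAt.comp p hd.hasMFDerivAt
  have h2 := ((hσ.contMDiffAt.mdifferentiableAt (by simp)).hasMFDerivAt).comp p
    (hasMFDerivAt_tulczyjewProj p)
  have h3 := ((((ContinuousLinearMap.fst ℝ (StrongDual ℝ E) (E × StrongDual ℝ E)).prod
    ((ContinuousLinearMap.snd ℝ E (StrongDual ℝ E)).comp
      (ContinuousLinearMap.snd ℝ (StrongDual ℝ E) (E × StrongDual ℝ E)))).hasMFDerivAt).comp p
        (hasMFDerivAt_snd (I := 𝓘(ℝ, E)) (I' := 𝓘(ℝ, TulczyjewFibre E)) (x := p))).sub h2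
  have h4 := DFunLike.congr_fun (hasMFDerivAt_unique h1 h3) v
  rw [LinearMap.mem_ker]
  refine (Eq.congr_left h4).trans ?_
  exact sub_eq_zero

end Smooth

end LieGroups

/-! ### `S` is isotropic and maximally so -/

section LieGroups

variable {E G : Type*} [NormedAddCommGroup E] [NormedSpace ℝ E]
  [TopologicalSpace G] [ChartedSpace E G]

/-- The expression in the chart at `q` of the section `(g, ξ) ↦ (g, a, ξ, b)`, where
`(a, b) = σ (g, ξ)`. -/
def sectionInChart (σ : G × E → StrongDual ℝ E × StrongDual ℝ E) (q : G × E) (z : E × E) :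
    E × TulczyjewFibre E :=
  (z.1, (σ ((extChartAt 𝓘(ℝ, E) q.1).symm z.1, z.2)).1, z.2,
    (σ ((extChartAt 𝓘(ℝ, E) q.1).symm z.1, z.2)).2)

/-- The derivative of `sectionInChart` when `σ` has derivative `D`. -/
def sectionDeriv (D : E × E →L[ℝ] StrongDual ℝ E × StrongDual ℝ E) :
    E × E →L[ℝ] E × TulczyjewFibre E :=
  (ContinuousLinearMap.fst ℝ E E).prod
    (((ContinuousLinearMap.fst ℝ (StrongDual ℝ E) (StrongDual ℝ E)).comp D).prod
      ((ContinuousLinearMap.snd ℝ E E).prod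
        ((ContinuousLinearMap.snd ℝ (StrongDual ℝ E) (StrongDual ℝ E)).comp D)))

lemma sectionDeriv_apply (D : E × E →L[ℝ] StrongDual ℝ E × StrongDual ℝ E) (ζ : E × E) :
    sectionDeriv D ζ = (ζ.1, (D ζ).1, ζ.2, (D ζ).2) := rfl

/-- At the base point the inverse chart has identity derivative, so the manifold derivative of `σ`
is also its derivative in the chart. -/
lemma hasMFDerivAt_prodMap_extChartAt_symm [IsManifold 𝓘(ℝ, E) 1 G] (q : G × E) :
    HasMFDerivAt 𝓘(ℝ, E × E) (𝓘(ℝ, E).prod 𝓘(ℝ, E))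
      (fun z : E × E => ((extChartAt 𝓘(ℝ, E) q.1).symm z.1, z.2))
      (extChartAt 𝓘(ℝ, E) q.1 q.1, q.2) (ContinuousLinearMap.id ℝ (E × E)) := by
  have h0 := (mdifferentiableAt_extChartAt_symm
    (mem_extChartAt_target (I := 𝓘(ℝ, E)) q.1)).hasMFDerivAt
  rw [mfderiv_extChartAt_symm_self] at h0
  have h1 := HasMFDerivAt.comp (f := (Prod.fst : E × E → E))
    (extChartAt 𝓘(ℝ, E) q.1 q.1, q.2) h0 (ContinuousLinearMap.fst ℝ E E).hasMFDerivAt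
  exact h1.prodMk (ContinuousLinearMap.snd ℝ E E).hasMFDerivAt

lemma hasFDerivAt_sectionInChart [IsManifold 𝓘(ℝ, E) 1 G]
    {σ : G × E → StrongDual ℝ E × StrongDual ℝ E}
    {q : G × E} {D : E × E →L[ℝ] StrongDual ℝ E × StrongDual ℝ E}
    (hσ : HasMFDerivAt (𝓘(ℝ, E).prod 𝓘(ℝ, E)) 𝓘(ℝ, StrongDual ℝ E × StrongDual ℝ E) σ q D) :
    HasFDerivAt (sectionInChart σ q) (sectionDeriv D) (extChartAt 𝓘(ℝ, E) q.1 q.1, q.2) := by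
  have key : ∀ q' : G × E, q' = q → HasMFDerivAt (𝓘(ℝ, E).prod 𝓘(ℝ, E))
      𝓘(ℝ, StrongDual ℝ E × StrongDual ℝ E) σ q' D := by
    rintro _ rfl
    exact hσ
  have h1 : HasFDerivAt (fun z : E × E => σ ((extChartAt 𝓘(ℝ, E) q.1).symm z.1, z.2)) D
      (extChartAt 𝓘(ℝ, E) q.1 q.1, q.2) :=
    (HasMFDerivAt.comp (extChartAt 𝓘(ℝ, E) q.1 q.1, q.2)
      (key _ (Prod.ext (extChartAt_to_inv (I := 𝓘(ℝ, E)) q.1) rfl))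
      (hasMFDerivAt_prodMap_extChartAt_symm q)).hasFDerivAt
  exact hasFDerivAt_fst.prodMk (h1.fst.prodMk (hasFDerivAt_snd.prodMk h1.snd))

lemma contDiffAt_comp_extChartAt_symm [IsManifold 𝓘(ℝ, E) ∞ G] {L : G × E → ℝ}
    (hL : ContMDiff (𝓘(ℝ, E).prod 𝓘(ℝ, E)) 𝓘(ℝ, ℝ) ∞ L) (q : G × E) :
    ContDiffAt ℝ ∞ (fun z : E × E => L ((extChartAt 𝓘(ℝ, E) q.1).symm z.1, z.2))
      (extChartAt 𝓘(ℝ, E) q.1 q.1, q.2) := by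
  have h0 : ContMDiffAt 𝓘(ℝ, E) 𝓘(ℝ, E) ∞ (extChartAt 𝓘(ℝ, E) q.1).symm
      (extChartAt 𝓘(ℝ, E) q.1 q.1) :=
    (contMDiffOn_extChartAt_symm (I := 𝓘(ℝ, E)) (n := ∞) q.1).contMDiffAt
      (extChartAt_target_mem_nhds (I := 𝓘(ℝ, E)) q.1)
  have h1 := ContMDiffAt.comp (f := (Prod.fst : E × E → E)) (I := 𝓘(ℝ, E × E))
    (extChartAt 𝓘(ℝ, E) q.1 q.1, q.2) h0 contDiffAt_fst.contMDiffAt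
  have h2 : ContMDiffAt 𝓘(ℝ, E × E) 𝓘(ℝ, E) ∞ (Prod.snd : E × E → E)
    (extChartAt 𝓘(ℝ, E) q.1 q.1, q.2) := contDiffAt_snd.contMDiffAt
  exact (hL.contMDiffAt.comp _ (h1.prodMk h2)).contDiffAt

variable [Group G]

/-- The section of `¹TT^*G` over `G × 𝔤` whose image is `lagrangianSet L`. -/
def lagrangianSection (L : G × E → ℝ) (q : G × E) : StrongDual ℝ E × StrongDual ℝ E :=
  (deltaXi L q.1 q.2, rightDual q.1 (deltaG L q.1 q.2))

lemma lagrangianSet_eq_graph [LieGroup 𝓘(ℝ, E) ∞ G] {L : G × E → ℝ}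
    (hL : ContMDiff (𝓘(ℝ, E).prod 𝓘(ℝ, E)) 𝓘(ℝ, ℝ) ∞ L) :
    lagrangianSet L = {p : TulczyjewSpace E G |
      (p.2.1, p.2.2.2) = lagrangianSection L (tulczyjewProj p)} := by
  ext p
  rw [mem_lagrangianSet_iff hL]
  exact Prod.mk_inj.symm

lemma contMDiff_lagrangianSection [LieGroup 𝓘(ℝ, E) ∞ G] {L : G × E → ℝ}
    (hL : ContMDiff (𝓘(ℝ, E).prod 𝓘(ℝ, E)) 𝓘(ℝ, ℝ) ∞ L) :
    ContMDiff (𝓘(ℝ, E).prod 𝓘(ℝ, E)) 𝓘(ℝ, StrongDual ℝ E × StrongDual ℝ E) ∞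
      (lagrangianSection L) :=
  (contMDiff_deltaXi hL).prodMk_space (contMDiff_rightDual_deltaG hL)

/-- In a chart, the pullback of `θ₂` by the section `lagrangianSection L` is `dL`. -/
lemma theta2InChart_sectionInChart [LieGroup 𝓘(ℝ, E) ∞ G] {L : G × E → ℝ}
    (hL : ContMDiff (𝓘(ℝ, E).prod 𝓘(ℝ, E)) 𝓘(ℝ, ℝ) ∞ L) (q : G × E) {z : E × E}
    (hz : z.1 ∈ (extChartAt 𝓘(ℝ, E) q.1).target)
    (hl : DifferentiableAt ℝ
      (fun z : E × E => L ((extChartAt 𝓘(ℝ, E) q.1).symm z.1, z.2)) z) :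
    theta2InChart q.1 (sectionInChart (lagrangianSection L) q z) =
      (fderiv ℝ (fun z : E × E => L ((extChartAt 𝓘(ℝ, E) q.1).symm z.1, z.2)) z).comp
        (tulczyjewProjL E) := by
  have : IsManifold 𝓘(ℝ, E) 1 G := .of_le (n := ∞) (by simp)
  -- Only the `G` component of `p` matters: the chart is the identity on the fibre.
  set p : TulczyjewSpace E G := (q.1, 0, q.2, 0)
  set y := sectionInChart (lagrangianSection L) q z
  have hs := hasMFDerivAt_extChartAt_tulczyjewSpace_symm p (y := y) hz
  have hmem : (extChartAt (tulczyjewModel E) p).symm y ∈ lagrangianSet L := by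
    rw [lagrangianSet_eq_graph hL, extChartAt_tulczyjewSpace_symm]
    rfl
  rw [← formInChart_theta2 p (y := y) hz]
  have h1 := ((hL.contMDiffAt.mdifferentiableAt (by simp)).hasMFDerivAt).comp y
    ((hasMFDerivAt_tulczyjewProj _).comp y hs)
  have h2 : HasFDerivAt (fun y : E × TulczyjewFibre E =>
      L ((extChartAt 𝓘(ℝ, E) q.1).symm (tulczyjewProjL E y).1, (tulczyjewProjL E y).2)) _ y :=
    HasFDerivAt.comp (f := tulczyjewProjL E) y hl.hasFDerivAt (tulczyjewProjL E).hasFDerivAt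
  have h3 := hasMFDerivAt_unique h1 (by
    rw [extChartAt_tulczyjewSpace_symm]
    exact h2.hasMFDerivAt)
  refine Eq.trans ?_ h3
  rw [formInChart, pullbackForm, hs.mfderiv, ← show _ = theta2 _ from hmem, pullbackForm,
    (hasMFDerivAt_tulczyjewProj _).mfderiv]
  rfl

/-- This is the derivative in `z`, in direction `ζ`, of the identity `θ₂(s(z)) w = dl(z)(π w)`,
where `s` is the section, `π` the projection and `l` is `L` in the chart. Here `w` is a constant
vector, not necessarily tangent to `S`. -/
lemma fderiv_theta2InChart_sectionDeriv [LieGroup 𝓘(ℝ, E) ∞ G] {L : G × E → ℝ}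
    (hL : ContMDiff (𝓘(ℝ, E).prod 𝓘(ℝ, E)) 𝓘(ℝ, ℝ) ∞ L)
    {p : TulczyjewSpace E G} (hp : p ∈ lagrangianSet L)
    {D : E × E →L[ℝ] StrongDual ℝ E × StrongDual ℝ E}
    (hD : HasMFDerivAt (𝓘(ℝ, E).prod 𝓘(ℝ, E)) 𝓘(ℝ, StrongDual ℝ E × StrongDual ℝ E)
      (lagrangianSection L) (tulczyjewProj p) D) (ζ : E × E) (w : E × TulczyjewFibre E) :
    fderiv ℝ (theta2InChart p.1) (extChartAt (tulczyjewModel E) p p) (sectionDeriv D ζ) w =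
      fderiv ℝ (fderiv ℝ fun z : E × E => L ((extChartAt 𝓘(ℝ, E) p.1).symm z.1, z.2))
        (extChartAt 𝓘(ℝ, E) p.1 p.1, p.2.2.1) ζ (tulczyjewProjL E w) := by
  have : IsManifold 𝓘(ℝ, E) 1 G := .of_le (n := ∞) (by simp)
  set l := fun z : E × E => L ((extChartAt 𝓘(ℝ, E) p.1).symm z.1, z.2)
  set z₀ : E × E := (extChartAt 𝓘(ℝ, E) p.1 p.1, p.2.2.1)
  have hl : ContDiffAt ℝ ∞ l z₀ := contDiffAt_comp_extChartAt_symm hL (tulczyjewProj p)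
  have hbase : sectionInChart (lagrangianSection L) (tulczyjewProj p) z₀ =
      extChartAt (tulczyjewModel E) p p := by
    rw [lagrangianSet_eq_graph hL] at hp
    have hp' : (p.2.1, p.2.2.2) = lagrangianSection L (tulczyjewProj p) := hp
    have hb : (((extChartAt 𝓘(ℝ, E) p.1).symm z₀.1, z₀.2) : G × E) = tulczyjewProj p :=
      Prod.ext (extChartAt_to_inv (I := 𝓘(ℝ, E)) p.1) rfl
    have hx : lagrangianSection L ((extChartAt 𝓘(ℝ, E) p.1).symm z₀.1, z₀.2) =
        (p.2.1, p.2.2.2) :=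
      (congrArg (lagrangianSection L) hb).trans hp'.symm
    rw [extChartAt_tulczyjewSpace_apply]
    exact congrArg (fun a : StrongDual ℝ E × StrongDual ℝ E =>
      ((extChartAt 𝓘(ℝ, E) p.1 p.1, a.1, p.2.2.1, a.2) : E × TulczyjewFibre E)) hx
  -- The identity is needed on a neighbourhood of `z₀`, since it is about to be differentiated.
  have hev : ∀ᶠ z in nhds z₀, theta2InChart p.1
      (sectionInChart (lagrangianSection L) (tulczyjewProj p) z) =
        (fderiv ℝ l z).comp (tulczyjewProjL E) := by
    have e1 : ∀ᶠ z in nhds z₀, z.1 ∈ (extChartAt 𝓘(ℝ, E) p.1).target :=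
      continuous_fst.continuousAt.preimage_mem_nhds
        (extChartAt_target_mem_nhds (I := 𝓘(ℝ, E)) p.1)
    have e2 : ∀ᶠ z in nhds z₀, ContDiffAt ℝ 1 l z :=
      (hl.of_le (m := 1) (by simp)).eventually (by simp)
    filter_upwards [e1, e2] with z hz hlz
    exact theta2InChart_sectionInChart hL (tulczyjewProj p) hz
      (hlz.differentiableAt (by simp))
  have hθ := ((contDiffAt_theta2InChart p).differentiableAt (by simp)).hasFDerivAt
  rw [← hbase] at hθ ⊢
  have h1 := (HasFDerivAt.comp z₀ hθ (hasFDerivAt_sectionInChart hD)).clm_apply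
    (hasFDerivAt_const w z₀)
  have h2 := ((hl.fderiv_right (m := ∞) (by simp)).differentiableAt (by simp)).hasFDerivAt.clm_apply
    (hasFDerivAt_const (tulczyjewProjL E w) z₀)
  have h3 := DFunLike.congr_fun (h1.unique (h2.congr_of_eventuallyEq
    (hev.mono fun z hz => DFunLike.congr_fun hz w))) ζ
  simpa using h3

/-- Tangent vectors to `S` project to `ζ` and `η`, so the two halves of `Ω` are `D²l(ζ, η)` and
`D²l(η, ζ)`, which agree by symmetry of the second derivative. -/
lemma tulczyjewForm_sectionDeriv [LieGroup 𝓘(ℝ, E) ∞ G] {L : G × E → ℝ}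
    (hL : ContMDiff (𝓘(ℝ, E).prod 𝓘(ℝ, E)) 𝓘(ℝ, ℝ) ∞ L)
    {p : TulczyjewSpace E G} (hp : p ∈ lagrangianSet L)
    {D : E × E →L[ℝ] StrongDual ℝ E × StrongDual ℝ E}
    (hD : HasMFDerivAt (𝓘(ℝ, E).prod 𝓘(ℝ, E)) 𝓘(ℝ, StrongDual ℝ E × StrongDual ℝ E)
      (lagrangianSection L) (tulczyjewProj p) D) (ζ η : E × E) :
    tulczyjewForm p (sectionDeriv D ζ) (sectionDeriv D η) = 0 := by
  have : IsManifold 𝓘(ℝ, E) 1 G := .of_le (n := ∞) (by simp)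
  have hsymm := (contDiffAt_comp_extChartAt_symm hL (tulczyjewProj p)).isSymmSndFDerivAt
    (by rw [minSmoothness_of_isRCLikeNormedField]; exact WithTop.coe_le_coe.2 le_top)
  rw [tulczyjewForm_eq, fderiv_theta2InChart_sectionDeriv hL hp hD,
    fderiv_theta2InChart_sectionDeriv hL hp hD, sub_eq_zero]
  exact hsymm ζ η

lemma isLagrangianSubmanifold_lagrangianSet [LieGroup 𝓘(ℝ, E) ∞ G] {L : G × E → ℝ}
    (hL : ContMDiff (𝓘(ℝ, E).prod 𝓘(ℝ, E)) 𝓘(ℝ, ℝ) ∞ L) :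
    IsLagrangianSubmanifold (tulczyjewModel E) tulczyjewForm
      (lagrangianSet L : Set (TulczyjewSpace E G)) := by
  intro p hp
  have hσ := contMDiff_lagrangianSection hL
  refine ⟨shearChart hσ p, (tulczyjewCoprojL E).ker, ?_, ?_⟩
  · rw [lagrangianSet_eq_graph hL]
    exact isSliceChart_shearChart hσ p
  have hD := (hσ.contMDiffAt.mdifferentiableAt (by simp)).hasMFDerivAt (x := tulczyjewProj p)
  set D : E × E →L[ℝ] StrongDual ℝ E × StrongDual ℝ E :=
    mfderiv (𝓘(ℝ, E).prod 𝓘(ℝ, E)) 𝓘(ℝ, StrongDual ℝ E × StrongDual ℝ E)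
      (lagrangianSection L) (tulczyjewProj p)
  have hT : ∀ v : E × TulczyjewFibre E,
      (show E × TulczyjewFibre E from mfderiv (tulczyjewModel E) 𝓘(ℝ, E × TulczyjewFibre E)
        ((shearChart hσ p).extend (tulczyjewModel E)) p v) ∈ (tulczyjewCoprojL E).ker ↔
        v = sectionDeriv D (tulczyjewProjL E v) := by
    intro v
    refine (mfderiv_shearChart_mem_ker hσ p v).trans ?_
    change (v.2.1, v.2.2.2) = D (v.1, v.2.2.1) ↔
      v = (v.1, (D (v.1, v.2.2.1)).1, v.2.2.1, (D (v.1, v.2.2.1)).2)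
    simp [Prod.ext_iff]
  have hT' : ∀ ζ : E × E,
      (show E × TulczyjewFibre E from mfderiv (tulczyjewModel E) 𝓘(ℝ, E × TulczyjewFibre E)
        ((shearChart hσ p).extend (tulczyjewModel E)) p (sectionDeriv D ζ)) ∈
          (tulczyjewCoprojL E).ker := fun ζ => (hT _).2 rfl
  have hiso := tulczyjewForm_sectionDeriv hL hp hD
  intro v
  constructor
  · intro hv w hw
    have e1 := (hT v).1 hv
    have e2 := (hT w).1 hw
    rw [e1, e2]
    exact hiso _ _
  · intro hv
    refine (hT v).2 ?_
    set v' : E × TulczyjewFibre E := v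
    -- Subtracting the tangent vector with the same projection leaves a vertical vector, still
    -- orthogonal to `TS` because `TS` is isotropic.
    set u : E × TulczyjewFibre E := v' - sectionDeriv D (tulczyjewProjL E v')
    have hu1 : u.1 = 0 := sub_self v'.1
    have hu2 : u.2.2.1 = 0 := sub_self v'.2.2.1
    -- For vertical `u` the Maurer–Cartan term drops out, and `Ω(u, ·)` on `TS` is the pairing of
    -- `(V_ν, V_μ)` with an arbitrary `(TR_{g⁻¹} V_g, V_ξ)`.
    have h : ∀ η : E × E,
        u.2.2.2 ((show E →L[ℝ] E from rightLower p.1) η.1) + u.2.1 η.2 = 0 := by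
      intro η
      have h1 : tulczyjewForm p u (sectionDeriv D η) = 0 := by
        have h2 : tulczyjewForm p u = tulczyjewForm p v' -
          tulczyjewForm p (sectionDeriv D (tulczyjewProjL E v')) := map_sub (tulczyjewForm p) _ _
        rw [h2]
        refine (congrArg₂ (· - ·) (hv _ (hT' η)) (hiso _ _)).trans (sub_zero 0)
      have h0 : (show E →L[ℝ] E from rightLower p.1) 0 = 0 := map_zero _
      rw [tulczyjewForm_apply, hu1, hu2, h0] at h1
      simpa [sectionDeriv_apply] using h1
    have hμ : u.2.1 = 0 := by
      ext η
      have := h (0, η)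
      rwa [map_zero, map_zero, zero_add] at this
    have hν : u.2.2.2 = 0 := by
      ext η
      have h1 := h (rightLift p.1 η, 0)
      rw [map_zero, add_zero] at h1
      refine (congrArg u.2.2.2 (rightLower_rightLift p.1 η)).symm.trans h1
    exact sub_eq_zero.1 (Prod.ext hu1 (Prod.ext hμ (Prod.ext hu2 hν)) : u = 0)

end LieGroups

end

theorem mainTheorem3 {E G : Type*} [NormedAddCommGroup E] [NormedSpace ℝ E]
    [TopologicalSpace G] [ChartedSpace E G] [Group G] [LieGroup 𝓘(ℝ, E) ∞ G]
    (hE : Function.Surjective (NormedSpace.inclusionInDoubleDual ℝ E))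
    (L : G × E → ℝ) (hL : ContMDiff (𝓘(ℝ, E).prod 𝓘(ℝ, E)) 𝓘(ℝ, ℝ) ∞ L) :
    -- the form `Ω = dθ₂` is non-degenerate, and `S` is Lagrangian for it
    (∀ p : TulczyjewSpace E G, Function.Bijective (tulczyjewForm p)) ∧
    IsLagrangianSubmanifold (tulczyjewModel E) tulczyjewForm (lagrangianSet L) ∧
    -- the explicit form of `S`
    lagrangianSet L = {p : TulczyjewSpace E G | ∃ (g : G) (ξ : E),
      p = (g, deltaXi L g ξ, ξ, rightDual g (deltaG L g ξ))} ∧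
    -- its image in `T(G × 𝔤^*)`
    reconstruction '' lagrangianSet L = {X : CotangentTangent E G | ∃ (g : G) (ξ : E),
      X = mkTangent g (deltaXi L g ξ) (rightLift g ξ)
        (rightDual g (deltaG L g ξ) + adStar G ξ (deltaXi L g ξ))} ∧
    -- the curves of this implicit differential equation are the Euler-Lagrange curves
    (∀ J : Set ℝ, IsOpen J → ∀ (g : ℝ → G) (μ : ℝ → StrongDual ℝ E),
      (∀ t ∈ J,
        MDifferentiableAt 𝓘(ℝ, ℝ) (𝓘(ℝ, E).prod 𝓘(ℝ, StrongDual ℝ E)) (fun s => (g s, μ s)) t ∧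
        tangentLift (fun s => (g s, μ s)) t ∈ reconstruction '' lagrangianSet L) ↔
      (SolvesEulerLagrange L J g ∧ ∀ t ∈ J, μ t = deltaXi L (g t) (trivVelocity g t))) := by
  exact ⟨tulczyjewForm_bijective hE, isLagrangianSubmanifold_lagrangianSet hL, lagrangianSet_eq hL,
    reconstruction_image_lagrangianSet hL,
    fun _ hJ g μ => tangentLift_mem_iff_solvesEulerLagrange hL hJ g μ⟩
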